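/- Let $\mathcal A$ be a unital $C^*$-algebra with centre $\mathcal Z(\mathcal A)$. An action $\alpha: G\curvearrowright\mathcal A$ of a discrete group $G$ is a homomorphism $G\to\mathrm{Aut}(\mathcal A)$ into the group of $*$-automorphisms. A map $h: G\to\mathcal Z(\mathcal A)$ is a positive definite multiplier for $\alpha$ if for all $n\in\mathbb N$ and $x_1,\dots,x_n\in G$ the matrix $[\alpha_{x_j}(h_{x_i^{-1}x_j})]_{ij}$ is positive in $M_n(\mathcal A)$; it vanishes at infinity if for every $\varepsilon>0$ there is a finite $F\subset G$ with $\|h_s\|<\varepsilon$ for all $s\in G\setminus F$. The action $\alpha$ has the Haagerup property if there is a sequence $(h_n)_{n\in\mathbb N}$ of positive definite multipliers for $\alpha$ vanishing at infinity such that $h_{n,s}\to 1_{\mathcal A}$ in norm for every $s\in G$; such a sequence is called a witness. Let $\Gamma=(V,E)$ be a simplicial graph (undirected, without loops or multiple edges), and for each $v\in V$ let $G_v$ be a discrete group with an action $\alpha_v: G_v\curvearrowright\mathcal A$; assume that only countably many of the groups $G_v$ are non-trivial. Let $\bigstar_\Gamma G_v$ be the graph product, i.e. the free product of the $G_v$ modulo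 the relations $[g,h]=1$ for $g\in G_v$, $h\in G_w$, $(v,w)\in E$. **Theorem.** Suppose that the actions commute according to $\Gamma$, that is, $\alpha_v(g)\alpha_w(h)=\alpha_w(h)\alpha_v(g)$ for all $(v,w)\in E$, $g\in G_v$, $h\in G_w$, and let $\bigstar_\Gamma\alpha_v:\bigstar_\Gamma G_v\curvearrowright\mathcal A$ be the action extending all the $\alpha_v$. Suppose that each $\alpha_v$ has the Haagerup property, with witnesses $(h_{v,n})_{n\in\mathbb N}$ such that for every $n$ the multipliers $\{h_{v,n}\}_{v\in V}$ commute according to $\Gamma$, that is, $\alpha_{v,a}(h_{w,n,b})=h_{w,n,b}$ and $\alpha_{w,b}(h_{v,n,a})=h_{v,n,a}$ for all $(v,w)\in E$, $a\in G_v$, $b\in G_w$. Then $\bigstar_\Gamma\alpha_v$ has the Haagerup property. -/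

import Mathlib

open Filter Topology

universe u v w

/-- The graph product of the groups `G v` over the simplicial graph `Γ`: the free product of the
`G v` modulo the relations `[g, h] = 1` for `g ∈ G v`, `h ∈ G w` and `v`, `w` adjacent in `Γ`. -/
abbrev GraphProduct {V : Type u} (Γ : SimpleGraph V) (G : V → Type v) [∀ x, Group (G x)] :
    Type (max u v) :=
  Monoid.CoprodI G ⧸ Subgroup.normalClosure
    {r : Monoid.CoprodI G | ∃ (x y : V) (_ : Γ.Adj x y) (g : G x) (h : G y),
      r = Monoid.CoprodI.of g * Monoid.CoprodI.of h *
        (Monoid.CoprodI.of g)⁻¹ * (Monoid.CoprodI.of h)⁻¹}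

namespace GraphProduct

/-- The canonical homomorphism of a vertex group into the graph product. -/
def of {V : Type u} (Γ : SimpleGraph V) (G : V → Type v) [∀ x, Group (G x)] (x : V) :
    G x →* GraphProduct Γ G :=
  (QuotientGroup.mk' _).comp Monoid.CoprodI.of

/-- The universal property of the graph product: homomorphisms on the vertex groups whose images
commute along the edges extend to the graph product. -/
def lift {V : Type u} (Γ : SimpleGraph V) {G : V → Type v} [∀ x, Group (G x)]
    {K : Type w} [Group K] (f : ∀ x, G x →* K)
    (hf : ∀ x y, Γ.Adj x y → ∀ (g : G x) (h : G y), f x g * f y h = f y h * f x g) :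
    GraphProduct Γ G →* K :=
  QuotientGroup.lift _ (Monoid.CoprodI.lift f) (by
    refine Subgroup.normalClosure_le_normal (N := (Monoid.CoprodI.lift f).ker) ?_
    rintro _ ⟨x, y, hxy, g, h, rfl⟩
    rw [SetLike.mem_coe, MonoidHom.mem_ker]
    simp only [map_mul, map_inv, Monoid.CoprodI.lift_of]
    rw [hf x y hxy g h]
    group)

theorem lift_of {V : Type u} (Γ : SimpleGraph V) {G : V → Type v} [∀ x, Group (G x)]
    {K : Type w} [Group K] (f : ∀ x, G x →* K)
    (hf : ∀ x y, Γ.Adj x y → ∀ (g : G x) (h : G y), f x g * f y h = f y h * f x g)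
    (x : V) (g : G x) : lift Γ f hf (of Γ G x g) = f x g :=
  Monoid.CoprodI.lift_of f g

end GraphProduct

/-- Actions `α x : G x → Aut(A)` commute according to `Γ`: the automorphisms `α x g` and `α y h`
commute whenever `x` and `y` are adjacent. -/
def ActionsCommute {V : Type u} (Γ : SimpleGraph V) {G : V → Type v} [∀ x, Group (G x)]
    {A : Type w} [CStarAlgebra A] (α : ∀ x, G x →* (A ≃⋆ₐ[ℂ] A)) : Prop :=
  ∀ x y, Γ.Adj x y → ∀ (g : G x) (h : G y), α x g * α y h = α y h * α x g

/-- The graph product of actions that commute according to `Γ`. -/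
def graphProductAction {V : Type u} (Γ : SimpleGraph V) {G : V → Type v} [∀ x, Group (G x)]
    {A : Type w} [CStarAlgebra A] (α : ∀ x, G x →* (A ≃⋆ₐ[ℂ] A)) (hα : ActionsCommute Γ α) :
    GraphProduct Γ G →* (A ≃⋆ₐ[ℂ] A) :=
  GraphProduct.lift Γ α hα

/-- A positive definite multiplier for the action `α`: a map `h` from `G` to the centre of `A`
such that every matrix `[α_{x_j}(h_{x_i⁻¹ x_j})]_{ij}` is positive in the C⋆-algebra `M_n(A)`. -/
structure IsPosDefMultiplier {G : Type v} [Group G] {A : Type w} [CStarAlgebra A]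
    [PartialOrder A] [StarOrderedRing A] (α : G →* (A ≃⋆ₐ[ℂ] A)) (h : G → A) : Prop where
  central : ∀ s, h s ∈ Set.center A
  posDef : ∀ (n : ℕ) (x : Fin n → G),
    0 ≤ CStarMatrix.ofMatrix (Matrix.of fun i j => α (x j) (h ((x i)⁻¹ * x j)))

/-- The functions in `C₀(G, A)` for a discrete group `G`. -/
def VanishesAtInfinity {G : Type v} {A : Type w} [CStarAlgebra A] (h : G → A) : Prop :=
  ∀ ε : ℝ, 0 < ε → ∃ F : Finset G, ∀ s, s ∉ F → ‖h s‖ < ε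

/-- `h` is a sequence of multipliers witnessing the Haagerup property of `α`. -/
structure WitnessesHaagerup {G : Type v} [Group G] {A : Type w} [CStarAlgebra A]
    [PartialOrder A] [StarOrderedRing A] (α : G →* (A ≃⋆ₐ[ℂ] A)) (h : ℕ → G → A) : Prop where
  multiplier : ∀ n, IsPosDefMultiplier α (h n)
  vanishes : ∀ n, VanishesAtInfinity (h n)
  tendsto_one : ∀ s, Tendsto (fun n => h n s) atTop (𝓝 1)

/-- The Haagerup property of an action of a discrete group on a unital C⋆-algebra. -/
def HaagerupProperty {G : Type v} [Group G] {A : Type w} [CStarAlgebra A]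
    [PartialOrder A] [StarOrderedRing A] (α : G →* (A ≃⋆ₐ[ℂ] A)) : Prop :=
  ∃ h : ℕ → G → A, WitnessesHaagerup α h

/-- Multipliers `h x : G x → A` commute according to `Γ`: for adjacent `x`, `y`, the action of
`G x` fixes the values of `h y` and the action of `G y` fixes the values of `h x`. -/
def MultipliersCommute {V : Type u} (Γ : SimpleGraph V) {G : V → Type v} [∀ x, Group (G x)]
    {A : Type w} [CStarAlgebra A] (α : ∀ x, G x →* (A ≃⋆ₐ[ℂ] A)) (h : ∀ x, G x → A) : Prop :=
  ∀ x y, Γ.Adj x y → ∀ (a : G x) (b : G y), α x a (h y b) = h y b ∧ α y b (h x a) = h x a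

/-! Write `β` for the product action. A kernel `K` on the graph product with central values,
positive finite matrices and `K (g s) (g t) = β g (K s t)` yields the multiplier `s ↦ K s⁻¹ 1`. Such
a `K` is built geometrically. Each coset `g G_x` carries a projection `s ↦ front x (g⁻¹ s)` to
`G_x`; the kernel of the multiplier at `x` is pulled back along it and twisted by `β g`. Since the
multipliers commute according to `Γ`, parallel cosets give the same kernel (`wallKernel_mk`), so
there is one kernel per wall. When the multipliers are `1` at the identity, a wall contributes `1`
unless it separates `s` from `t`, and only finitely many do (`separating_finite`). The product over
all walls is positive by the Schur product theorem for central kernels (`IsPosKernel.mul`).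

For the decay, peeling off the letters of a reduced word for `s` bounds `‖K 1 s‖` by the product of
the norms of the multipliers at these letters; the length is the number of walls separating `1` from
`s`. If these norms are at most some `ρ < 1` off the identity, and only finitely many letters reach
a given `ε > 0`, then `‖K 1 s‖ ≥ ε` leaves finitely many `s` (`finite_le_norm_centerKernel`). Both
conditions are arranged by scaling the multipliers, ever more strongly along an enumeration of the
non-trivial vertex groups, and resetting their value at the identity to `1`
(`isPosKernel_normalise`).

First letters are obtained without normal forms in graph products: `split` embeds the graph product
into a semidirect product over a free product of copies of `G_x`, where reduced words are available.
-/

/-- An `A`-valued kernel all of whose finite matrices are positive. -/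
def IsPosKernel {X : Type*} {A : Type*} [CStarAlgebra A] [PartialOrder A] [StarOrderedRing A]
    (K : X → X → A) : Prop :=
  ∀ (n : ℕ) (x : Fin n → X), 0 ≤ CStarMatrix.ofMatrix (Matrix.of fun i j => K (x i) (x j))

/-! ### Positive kernels with values in a C⋆-algebra, through Gram factorisations. -/

section Positivity

variable {A : Type*} [CStarAlgebra A] [PartialOrder A] [StarOrderedRing A]

theorem CStarAlgebra.exists_eq_star_mul_self {B : Type*} [NonUnitalCStarAlgebra B] [PartialOrder B]
    [StarOrderedRing B] {b : B} (hb : 0 ≤ b) : ∃ c, b = star c * c :=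
  CStarAlgebra.nonneg_iff_eq_star_mul_self.mp hb

theorem CStarMatrix.exists_gram_of_nonneg {n : ℕ} {M : Fin n → Fin n → A}
    (hM : 0 ≤ CStarMatrix.ofMatrix (Matrix.of M)) :
    ∃ d : Fin n → Fin n → A, ∀ i j, M i j = ∑ k, star (d k i) * d k j := by
  obtain ⟨B, hB⟩ := CStarAlgebra.exists_eq_star_mul_self hM
  refine ⟨fun k i => B k i, fun i j => ?_⟩
  have := congrArg (fun C : CStarMatrix (Fin n) (Fin n) A => C i j) hB
  simpa [CStarMatrix.mul_apply, CStarMatrix.star_apply] using this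

theorem CStarMatrix.nonneg_of_gram {n : ℕ} {κ : Type*} (s : Finset κ) (d : κ → Fin n → A) :
    0 ≤ CStarMatrix.ofMatrix
      (Matrix.of fun i j : Fin n => ∑ k ∈ s, star (d k i) * d k j) := by
  classical
  induction s using Finset.induction_on with
  | empty =>
    have : CStarMatrix.ofMatrix
        (Matrix.of fun i j : Fin n => ∑ k ∈ (∅ : Finset κ), star (d k i) * d k j) = 0 := by
      ext i j; simp
    rw [this]
  | insert k s hk ih =>
    rcases n with _ | n
    · exact le_of_eq (CStarMatrix.ext fun i => i.elim0)
    -- One Gram vector is a matrix supported in row `0`; this row exists because the empty size was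
    -- treated apart.
    let E : CStarMatrix (Fin (n + 1)) (Fin (n + 1)) A :=
      CStarMatrix.ofMatrix (Matrix.of fun i j => if i = 0 then d k j else 0)
    have hE : CStarMatrix.ofMatrix
        (Matrix.of fun i j : Fin (n + 1) => ∑ k ∈ insert k s, star (d k i) * d k j) =
        star E * E + CStarMatrix.ofMatrix
          (Matrix.of fun i j : Fin (n + 1) => ∑ k ∈ s, star (d k i) * d k j) := by
      ext i j
      simp [Finset.sum_insert hk, E, CStarMatrix.mul_apply, CStarMatrix.star_apply]
    rw [hE]
    exact add_nonneg (star_mul_self_nonneg E) ih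

namespace IsPosKernel

variable {X Y : Type*} {K K' : X → X → A}

theorem comp (hK : IsPosKernel K) (f : Y → X) : IsPosKernel fun x y => K (f x) (f y) :=
  fun n x => hK n (f ∘ x)

theorem map {B : Type*} [CStarAlgebra B] [PartialOrder B] [StarOrderedRing B]
    (hK : IsPosKernel K) (f : A →⋆ₐ[ℂ] B) :
    IsPosKernel fun x y => f (K x y) := by
  intro n x
  obtain ⟨d, hd⟩ := CStarMatrix.exists_gram_of_nonneg (hK n x)
  have := CStarMatrix.nonneg_of_gram Finset.univ fun k i => f (d k i)
  simpa [hd, map_star] using this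

theorem one : IsPosKernel fun _ _ : X => (1 : A) := by
  intro n x
  simpa using CStarMatrix.nonneg_of_gram (Finset.univ : Finset Unit) fun _ (_ : Fin n) => (1 : A)

theorem add (hK : IsPosKernel K) (hK' : IsPosKernel K') :
    IsPosKernel fun x y => K x y + K' x y :=
  fun n x => add_nonneg (hK n x) (hK' n x)

/-- The Schur product of two positive kernels, one of which is central, is positive. -/
theorem mul (hK : IsPosKernel K) (hK' : IsPosKernel K') (hc : ∀ x y, K' x y ∈ Set.center A) :
    IsPosKernel fun x y => K x y * K' x y := by
  intro n x
  obtain ⟨d, hd⟩ := CStarMatrix.exists_gram_of_nonneg (hK n x)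
  obtain ⟨e, he⟩ := CStarMatrix.exists_gram_of_nonneg (hK' n x)
  -- The order `e * d` puts `star e * e` in the middle, where it sums to the central entry of `K'`;
  -- `e` itself need not be central.
  have := CStarMatrix.nonneg_of_gram Finset.univ fun (k : Fin n × Fin n) i => e k.2 i * d k.1 i
  convert this using 5 with i j
  beta_reduce
  rw [Fintype.sum_prod_type, hd, Finset.sum_mul]
  refine Finset.sum_congr rfl fun k _ => ?_
  calc star (d k i) * d k j * K' (x i) (x j) = star (d k i) * K' (x i) (x j) * d k j := by
        rw [mul_assoc, mul_assoc, (Semigroup.mem_center_iff.mp (hc (x i) (x j)) (d k j))]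
    _ = _ := by simp [he, Finset.mul_sum, Finset.sum_mul, mul_assoc]

theorem smul (hK : IsPosKernel K) {r : ℝ} (hr : 0 ≤ r) : IsPosKernel fun x y => r • K x y := by
  intro n x
  obtain ⟨d, hd⟩ := CStarMatrix.exists_gram_of_nonneg (hK n x)
  have := CStarMatrix.nonneg_of_gram Finset.univ fun k i => (√r) • d k i
  convert this using 5 with i j
  simp [hd, Finset.smul_sum, smul_smul, Real.mul_self_sqrt hr]

open Classical in
theorem diagonal {d : X → A} (hd : ∀ x, 0 ≤ d x) :
    IsPosKernel fun x y => if x = y then d y else 0 := by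
  intro n x
  choose e he using fun x => CStarAlgebra.exists_eq_star_mul_self (hd x)
  -- Gram vectors are indexed by the points, not by their positions, since the tuple may repeat a
  -- point.
  have := CStarMatrix.nonneg_of_gram (Finset.univ.image x)
    fun k i => if x i = k then e k else 0
  convert this using 5 with i j
  rw [Finset.sum_eq_single (x j)]
  · by_cases h : x i = x j <;> simp [h, he]
  · intro b _ hb
    simp [hb.symm]
  · simp

/-- Cauchy–Schwarz in the Hilbert module `A²` applied to the Gram vectors. They are starred because
the inner product of `A` is `y * star x`. -/
theorem norm_sq_le (hK : IsPosKernel K) (x y : X) : ‖K x y‖ ^ 2 ≤ ‖K x x‖ * ‖K y y‖ := by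
  obtain ⟨d, hd⟩ := CStarMatrix.exists_gram_of_nonneg (hK 2 ![x, y])
  have h00 : K x x = _ := hd 0 0
  have h01 : K x y = _ := hd 0 1
  have h11 : K y y = _ := hd 1 1
  let p : Fin 2 → WithCStarModule A (Fin 2 → A) :=
    fun i => (WithCStarModule.equiv A _).symm fun k => star (d k i)
  have key : ∀ i j, inner A (p j) (p i) = ∑ k, star (d k i) * d k j := by
    intro i j
    simp [p, WithCStarModule.pi_inner, WithCStarModule.inner_def]
  have h1 := CStarModule.norm_inner_le (A := A) (WithCStarModule A (Fin 2 → A))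
    (x := p 1) (y := p 0)
  have h2 := CStarModule.norm_sq_eq A (x := p 0)
  have h3 := CStarModule.norm_sq_eq A (x := p 1)
  rw [key] at h1 h2 h3
  rw [h00, h01, h11, ← h2, ← h3, mul_comm, ← mul_pow]
  exact pow_le_pow_left₀ (norm_nonneg _) h1 2

end IsPosKernel

end Positivity

/-! ### First letters of reduced words in free products. -/

namespace Monoid.CoprodI

section Head

variable {ι : Type*} {M : ι → Type*} [∀ i, Monoid (M i)]

open Classical in
/-- The first letter of the reduced word of `m` if it lies in `M i`, and `1` otherwise. -/
noncomputable def head (i : ι) (m : CoprodI M) : M i :=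
  (Word.equivPair i (Word.equiv m)).head

open Classical in
/-- The index of the first letter of the reduced word of `m`. -/
noncomputable def headIdx (m : CoprodI M) : Option ι := (Word.equiv m).fstIdx

open Classical in
theorem equiv_of_mul {i : ι} (a : M i) (m : CoprodI M) :
    Word.equiv (of a * m) = of a • Word.equiv m := by
  refine Word.equiv.symm.injective ?_
  rw [Equiv.symm_apply_apply]
  change _ = Word.prod (of a • Word.equiv m)
  rw [Word.prod_smul]
  exact congrArg (of a * ·) (Word.equiv.symm_apply_apply m).symm

theorem head_of_mul (i : ι) (a : M i) (m : CoprodI M) : head i (of a * m) = a * head i m := by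
  classical
  rw [head, head, equiv_of_mul, Word.equivPair_smul_same]

theorem head_eq_one {i : ι} {m : CoprodI M} (h : headIdx m ≠ some i) : head i m = 1 := by
  classical
  rw [head, Word.equivPair_eq_of_fstIdx_ne h]

theorem headIdx_one : headIdx (1 : CoprodI M) = none := by
  classical
  have : Word.equiv (1 : CoprodI M) = Word.empty :=
    Word.equiv.symm.injective (Word.equiv.symm_apply_apply 1)
  rw [headIdx, this]
  rfl

theorem head_one (i : ι) : head i (1 : CoprodI M) = 1 :=
  head_eq_one (by simp [headIdx_one])

theorem headIdx_of_mul {i : ι} {a : M i} {m : CoprodI M} (ha : a ≠ 1) (h : headIdx m ≠ some i) :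
    headIdx (of a * m) = some i := by
  classical
  have h' : (Word.equiv m).fstIdx ≠ some i := h
  rw [headIdx, equiv_of_mul, ← Word.cons_eq_smul (h1 := h') (h2 := ha), Word.fstIdx_cons]

/-- Induction on the reduced word of an element of the free product. -/
theorem headIdx_induction {motive : CoprodI M → Prop} (one : motive 1)
    (of_mul : ∀ i (a : M i) m, a ≠ 1 → headIdx m ≠ some i → motive m → motive (of a * m))
    (m : CoprodI M) : motive m := by
  classical
  obtain ⟨w, rfl⟩ := Word.equiv.symm.surjective m
  induction w using Word.consRecOn with
  | empty => exact one
  | cons i a w h1 h2 ih =>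
    have : Word.equiv.symm (Word.cons a w h1 h2) = of a * Word.equiv.symm w :=
      Word.prod_cons i a w h2 h1
    rw [this]
    refine of_mul i a _ h2 ?_ ih
    rwa [headIdx, Equiv.apply_symm_apply]

theorem headIdx_of {i : ι} {a : M i} (ha : a ≠ 1) : headIdx (of a) = some i := by
  simpa using headIdx_of_mul ha (m := 1) (by simp [headIdx_one])

theorem headIdx_eq_of_head_ne_one {i : ι} {m : CoprodI M} (h : head i m ≠ 1) :
    headIdx m = some i := by
  by_contra h'
  exact h (head_eq_one h')

theorem headIdx_of_ne {i j : ι} (hij : j ≠ i) (a : M j) : headIdx (of a) ≠ some i := by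
  by_cases ha : a = 1
  · simp [ha, headIdx_one]
  · simpa [headIdx_of ha] using hij

/-- A letter appended on the right merges or cancels only with the last letter, so it reaches the
first one only in a one-letter word, where it keeps the index or leaves nothing. -/
theorem headIdx_mul_of {m : CoprodI M} (hm : m ≠ 1) {j : ι} (a : M j) :
    headIdx (m * of a) = none ∨ headIdx (m * of a) = headIdx m := by
  induction m using headIdx_induction with
  | one => exact absurd rfl hm
  | of_mul i b m hb hi ih =>
    rw [headIdx_of_mul hb hi]
    by_cases h : headIdx (m * of a) = some i
    · have h1 : m = 1 := by
        by_contra h1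
        rcases ih h1 with h2 | h2
        · simp [h2] at h
        · exact hi (h2 ▸ h)
      subst h1
      obtain rfl : j = i := by
        by_contra hji
        exact headIdx_of_ne hji a (by simpa using h)
      rw [mul_one, ← map_mul]
      by_cases hba : b * a = 1
      · left
        rw [hba, map_one, headIdx_one]
      · right
        rw [headIdx_of hba]
    · right
      rw [mul_assoc, headIdx_of_mul hb h]

/-- Multiplying by one letter on the right changes the first letter of a reduced word only if
that word has at most one letter. -/
theorem head_mul_of {i j : ι} {m : CoprodI M} {a : M j} (h : head i (m * of a) ≠ head i m) :
    j = i ∧ ∃ c : M i, m = of c := by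
  induction m using headIdx_induction with
  | one =>
    refine ⟨?_, 1, by simp⟩
    by_contra hji
    rw [one_mul, head_eq_one (headIdx_of_ne hji a), head_one] at h
    exact h rfl
  | of_mul k b m hb hk _ =>
    by_cases h' : headIdx (m * of a) = some k
    · have h1 : m = 1 := by
        by_contra h1
        rcases headIdx_mul_of h1 a with h2 | h2
        · simp [h2] at h'
        · exact hk (h2 ▸ h')
      subst h1
      obtain rfl : j = k := by
        by_contra hji
        exact headIdx_of_ne hji a (by simpa using h')
      rw [mul_one] at h ⊢
      by_cases hji : j = i
      · subst hji
        exact ⟨rfl, b, rfl⟩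
      · rw [← map_mul, head_eq_one (headIdx_of_ne hji _), head_eq_one (headIdx_of_ne hji _)] at h
        exact absurd rfl h
    · refine absurd ?_ h
      rw [mul_assoc]
      by_cases hki : k = i
      · subst hki
        rw [head_of_mul, head_of_mul, head_eq_one h', head_eq_one hk]
      · rw [head_eq_one, head_eq_one]
        · simpa [headIdx_of_mul hb hk] using hki
        · simpa [headIdx_of_mul hb h'] using hki

end Head

section Reindex

variable {ι : Type*} {H : Type*} [Group H]

/-- Permutations of the index set act on a free product of copies of one group. -/
def reindex : Equiv.Perm ι →* MulAut (CoprodI fun _ : ι => H) where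
  toFun σ := MonoidHom.toMulEquiv
    (lift fun i => of (M := fun _ : ι => H) (i := σ i))
    (lift fun i => of (M := fun _ : ι => H) (i := σ.symm i))
    (by
      ext i x
      simp)
    (by
      ext i x
      simp)
  map_one' := by
    ext x
    change lift (fun i => of (M := fun _ : ι => H) (i := i)) x = x
    rw [lift_of']
    rfl
  map_mul' σ τ := by
    ext x
    induction x using induction_left with
    | one => simp
    | mul a x ih =>
      rw [map_mul, map_mul, ih]
      congr 1

theorem reindex_of (σ : Equiv.Perm ι) (i : ι) (a : H) :
    reindex σ (of (M := fun _ : ι => H) (i := i) a) =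
      of (M := fun _ : ι => H) (i := σ i) a :=
  lift_of _ _

theorem head_reindex (σ : Equiv.Perm ι) (m : CoprodI fun _ : ι => H) (i : ι) :
    head (σ i) (reindex σ m) = head i m := by
  induction m using headIdx_induction generalizing i with
  | one => rw [map_one, head_one, head_one]
  | of_mul k a m ha hk ih =>
    rw [map_mul, reindex_of]
    by_cases hki : k = i
    · subst hki
      rw [head_of_mul, head_of_mul, ih]
    · have h0 : head i (of a * m) = 1 :=
        head_eq_one ((headIdx_of_mul (M := fun _ : ι => H) ha hk).trans_ne (by simpa using hki))
      rw [h0]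
      refine head_eq_one fun h => hki (σ.injective ?_)
      have h1 : head (σ k) (of (M := fun _ : ι => H) (i := σ k) a * reindex σ m) ≠ 1 := by
        rw [head_of_mul, ih, head_eq_one hk, mul_one]
        exact ha
      have h2 := headIdx_eq_of_head_ne_one h1
      rw [h] at h2
      exact (Option.some.inj h2).symm

end Reindex

end Monoid.CoprodI

/-! ### Generators, link subgroups and retractions of the graph product. -/

namespace GraphProduct

section Basic

variable {V : Type*} (Γ : SimpleGraph V) (G : V → Type*) [∀ x, Group (G x)]

/-- The product in the graph product of a list of letters. -/
def listProd (l : List (Σ x, G x)) : GraphProduct Γ G := (l.map fun p => of Γ G p.1 p.2).prod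

theorem listProd_append_singleton (l : List (Σ x, G x)) (x : V) (a : G x) :
    listProd Γ G (l ++ [⟨x, a⟩]) = listProd Γ G l * of Γ G x a := by
  simp [listProd]

theorem exists_listProd (s : GraphProduct Γ G) : ∃ l, listProd Γ G l = s := by
  obtain ⟨m, rfl⟩ := QuotientGroup.mk'_surjective _ s
  induction m using Monoid.CoprodI.induction_left with
  | one => exact ⟨[], (map_one _).symm⟩
  | @mul x a m ih =>
    obtain ⟨l, hl⟩ := ih
    refine ⟨⟨x, a⟩ :: l, ?_⟩
    rw [map_mul, ← hl]
    simp only [listProd, List.map_cons, List.prod_cons]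
    rfl

variable {Γ G}

theorem induction_right {motive : GraphProduct Γ G → Prop} (one : motive 1)
    (mul : ∀ s x (a : G x), motive s → motive (s * of Γ G x a)) (s : GraphProduct Γ G) :
    motive s := by
  obtain ⟨l, rfl⟩ := exists_listProd Γ G s
  induction l using List.reverseRecOn with
  | nil => exact one
  | append_singleton l p ih =>
    rw [listProd_append_singleton]
    exact mul _ _ _ ih

theorem hom_ext {K : Type*} [Monoid K] {f g : GraphProduct Γ G →* K}
    (h : ∀ x a, f (of Γ G x a) = g (of Γ G x a)) : f = g := by
  refine MonoidHom.ext fun s => ?_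
  induction s using induction_right with
  | one => rw [map_one, map_one]
  | mul s x a ih => rw [map_mul, map_mul, ih, h]

theorem of_commute {x y : V} (h : Γ.Adj x y) (a : G x) (b : G y) :
    of Γ G x a * of Γ G y b = of Γ G y b * of Γ G x a := by
  rw [← mul_inv_eq_iff_eq_mul, ← mul_inv_eq_one]
  have : Monoid.CoprodI.of a * Monoid.CoprodI.of b * (Monoid.CoprodI.of a)⁻¹ *
      (Monoid.CoprodI.of b)⁻¹ ∈ Subgroup.normalClosure
    {r : Monoid.CoprodI G | ∃ (x y : V) (_ : Γ.Adj x y) (g : G x) (h : G y),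
      r = Monoid.CoprodI.of g * Monoid.CoprodI.of h *
        (Monoid.CoprodI.of g)⁻¹ * (Monoid.CoprodI.of h)⁻¹} :=
    Subgroup.subset_normalClosure ⟨x, y, h, a, b, rfl⟩
  exact (QuotientGroup.eq_one_iff _).mpr this

variable (Γ G) in
/-- The subgroup generated by the vertex groups adjacent to `x`. -/
def link (x : V) : Subgroup (GraphProduct Γ G) :=
  Subgroup.closure {s | ∃ y, Γ.Adj x y ∧ ∃ b : G y, of Γ G y b = s}

theorem of_mem_link {x y : V} (h : Γ.Adj x y) (b : G y) : of Γ G y b ∈ link Γ G x :=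
  Subgroup.subset_closure ⟨y, h, b, rfl⟩

theorem link_commute {x : V} {l : GraphProduct Γ G} (hl : l ∈ link Γ G x) (a : G x) :
    l * of Γ G x a = of Γ G x a * l := by
  have : link Γ G x ≤ Subgroup.centralizer {of Γ G x a} := by
    refine (Subgroup.closure_le _).mpr ?_
    rintro _ ⟨y, hxy, b, rfl⟩
    simpa [Subgroup.mem_centralizer_iff] using of_commute hxy a b
  simpa [Subgroup.mem_centralizer_iff, eq_comm] using this hl

-- Allows the homomorphism at one vertex to be replaced; both `kill` and `split` arise in this way.
open Classical in
theorem update_commute {K : Type*} [Group K] (x : V) (f : G x →* K) (g : ∀ y, G y →* K)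
    (hf : ∀ y, Γ.Adj x y → ∀ a b, f a * g y b = g y b * f a)
    (hg : ∀ y z, Γ.Adj y z → ∀ a b, g y a * g z b = g z b * g y a) (y z : V) (h : Γ.Adj y z)
    (a : G y) (b : G z) :
    Function.update g x f y a * Function.update g x f z b =
      Function.update g x f z b * Function.update g x f y a := by
  by_cases hy : y = x
  · subst hy
    rw [Function.update_self, Function.update_of_ne h.ne', hf z h]
  · by_cases hz : z = x
    · subst hz
      rw [Function.update_self, Function.update_of_ne hy, hf y h.symm]
    · rw [Function.update_of_ne hy, Function.update_of_ne hz, hg y z h]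

open Classical in
variable (Γ G) in
/-- The retraction of the graph product that kills the vertex group at `x`. -/
noncomputable def kill (x : V) : GraphProduct Γ G →* GraphProduct Γ G :=
  lift Γ (Function.update (of Γ G) x 1)
    (update_commute x _ _ (by simp) fun _ _ h => of_commute h)

theorem kill_of_self (x : V) (a : G x) : kill Γ G x (of Γ G x a) = 1 := by
  classical
  rw [kill, lift_of, Function.update_self, MonoidHom.one_apply]

theorem kill_of_ne {x y : V} (h : y ≠ x) (a : G y) : kill Γ G x (of Γ G y a) = of Γ G y a := by
  classical
  rw [kill, lift_of, Function.update_of_ne h]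

theorem kill_of_mem_link {x : V} {l : GraphProduct Γ G} (hl : l ∈ link Γ G x) :
    kill Γ G x l = l := by
  have : link Γ G x ≤ (kill Γ G x).eqLocus (MonoidHom.id _) := by
    refine (Subgroup.closure_le _).mpr ?_
    rintro _ ⟨y, hxy, b, rfl⟩
    exact kill_of_ne hxy.ne' b
  exact this hl

/-- Deleting the letters at `x` never lengthens a word; this drives the induction in
`eq_one_of_front_eq_one`. -/
theorem exists_listProd_kill (x : V) (l : List (Σ y, G y)) :
    ∃ l', l'.length ≤ l.length ∧ listProd Γ G l' = kill Γ G x (listProd Γ G l) := by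
  induction l with
  | nil => exact ⟨[], le_rfl, (map_one _).symm⟩
  | cons p l ih =>
    obtain ⟨y, a⟩ := p
    obtain ⟨l', h1, h2⟩ := ih
    have h3 : listProd Γ G (⟨y, a⟩ :: l) = of Γ G y a * listProd Γ G l := by simp [listProd]
    rw [h3, map_mul, ← h2]
    by_cases h : y = x
    · subst h
      exact ⟨l', h1.trans (by simp), by rw [kill_of_self, one_mul]⟩
    · exact ⟨⟨y, a⟩ :: l', by simpa using h1, by simp [kill_of_ne h, listProd]⟩

end Basic

/-! ### The first letter at a vertex, via a semidirect product. -/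

section Front

open Monoid (CoprodI)

variable {V : Type*} (Γ : SimpleGraph V) (G : V → Type*) [∀ x, Group (G x)]

/-- The free product of copies of the vertex group at `x`, indexed by the cosets of the link
subgroup. It contains the kernel of `kill Γ G x`. -/
abbrev ConjProduct (x : V) : Type _ := CoprodI fun _ : GraphProduct Γ G ⧸ link Γ G x => G x

/-- The inclusion of the copy of `G x` in `ConjProduct Γ G x` with index `q`. -/
abbrev conjOf (x : V) (q : GraphProduct Γ G ⧸ link Γ G x) : G x →* ConjProduct Γ G x :=
  CoprodI.of (M := fun _ : GraphProduct Γ G ⧸ link Γ G x => G x) (i := q)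

/-- The action of the graph product on `ConjProduct Γ G x` by translation of the cosets. -/
def conjAction (x : V) : GraphProduct Γ G →* MulAut (ConjProduct Γ G x) :=
  CoprodI.reindex.comp (MulAction.toPermHom (GraphProduct Γ G) (GraphProduct Γ G ⧸ link Γ G x))

variable {Γ G}

theorem conjAction_conjOf (x : V) (s : GraphProduct Γ G) (q : GraphProduct Γ G ⧸ link Γ G x)
    (a : G x) : conjAction Γ G x s (conjOf Γ G x q a) = conjOf Γ G x (s • q) a :=
  CoprodI.reindex_of _ _ _

theorem smul_coe_one_eq_iff {x : V} {l : GraphProduct Γ G} :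
    l • ((1 : GraphProduct Γ G) : GraphProduct Γ G ⧸ link Γ G x) = (1 : GraphProduct Γ G) ↔
      l ∈ link Γ G x := by
  rw [MulAction.Quotient.smul_coe, smul_eq_mul, mul_one, QuotientGroup.eq, mul_one, inv_mem_iff]

open Classical in
variable (Γ G) in
/-- The embedding of the graph product into a semidirect product that separates the vertex group
at `x` from the others. -/
noncomputable def split (x : V) :
    GraphProduct Γ G →* ConjProduct Γ G x ⋊[conjAction Γ G x] GraphProduct Γ G :=
  lift Γ (Function.update (fun y => SemidirectProduct.inr.comp (of Γ G y)) x
      (SemidirectProduct.inl.comp (conjOf Γ G x (1 : GraphProduct Γ G))))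
    (update_commute x _ _
      (fun y h a b => by
        -- The link fixes the trivial coset, hence commutes with the copy of `G x` indexed by it;
        -- this is why copies are indexed by cosets of the link.
        have : conjAction Γ G x (of Γ G y b) (conjOf Γ G x (1 : GraphProduct Γ G) a) =
            conjOf Γ G x (1 : GraphProduct Γ G) a := by
          rw [conjAction_conjOf, smul_coe_one_eq_iff.mpr (of_mem_link h b)]
        simp only [MonoidHom.comp_apply]
        conv_lhs => rw [← this]
        rw [SemidirectProduct.inl_aut]
        simp)
      (fun y z h a b => by
        simp only [MonoidHom.comp_apply, ← map_mul, of_commute h a b]))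

theorem split_of_self (x : V) (a : G x) :
    split Γ G x (of Γ G x a) = SemidirectProduct.inl (conjOf Γ G x (1 : GraphProduct Γ G) a) := by
  classical
  rw [split, lift_of, Function.update_self, MonoidHom.comp_apply]

theorem split_of_ne {x y : V} (h : y ≠ x) (a : G y) :
    split Γ G x (of Γ G y a) = SemidirectProduct.inr (of Γ G y a) := by
  classical
  rw [split, lift_of, Function.update_of_ne h, MonoidHom.comp_apply]

theorem split_of_mem_link {x : V} {l : GraphProduct Γ G} (hl : l ∈ link Γ G x) :
    split Γ G x l = SemidirectProduct.inr l := by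
  have : link Γ G x ≤ (split Γ G x).eqLocus SemidirectProduct.inr := by
    refine (Subgroup.closure_le _).mpr ?_
    rintro _ ⟨y, hxy, b, rfl⟩
    exact split_of_ne hxy.ne' b
  exact this hl

variable (Γ G) in
/-- The map from `ConjProduct Γ G x` to the graph product that sends the copy of `G x` with index
`s • link` to its conjugate by `s`. -/
noncomputable def conjProductHom (x : V) : ConjProduct Γ G x →* GraphProduct Γ G :=
  CoprodI.lift fun q => (MulAut.conj q.out).toMonoidHom.comp (of Γ G x)

/-- The chosen representative of the coset is immaterial, because the link commutes with `G x`. -/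
theorem conjProductHom_conjOf (x : V) (s : GraphProduct Γ G) (a : G x) :
    conjProductHom Γ G x (conjOf Γ G x s a) = s * of Γ G x a * s⁻¹ := by
  obtain ⟨⟨l, hl⟩, h⟩ := QuotientGroup.mk_out_eq_mul (link Γ G x) s
  rw [conjProductHom, CoprodI.lift_of]
  simp only [MonoidHom.comp_apply, MulEquiv.coe_toMonoidHom, MulAut.conj_apply, h]
  rw [mul_inv_rev, mul_assoc s, link_commute hl]
  group

variable (Γ G) in
/-- The left inverse of `split`. -/
noncomputable def unsplit (x : V) :
    ConjProduct Γ G x ⋊[conjAction Γ G x] GraphProduct Γ G →* GraphProduct Γ G :=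
  SemidirectProduct.lift (conjProductHom Γ G x) (MonoidHom.id _) fun s => by
    refine CoprodI.ext_hom _ _ fun q => ?_
    ext a
    obtain ⟨t, rfl⟩ := QuotientGroup.mk_surjective q
    change conjProductHom Γ G x (conjAction Γ G x s (conjOf Γ G x t a)) =
      s * conjProductHom Γ G x (conjOf Γ G x t a) * s⁻¹
    rw [conjAction_conjOf, MulAction.Quotient.smul_coe, conjProductHom_conjOf,
      conjProductHom_conjOf, smul_eq_mul]
    group

theorem unsplit_split (x : V) (s : GraphProduct Γ G) : unsplit Γ G x (split Γ G x s) = s := by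
  suffices (unsplit Γ G x).comp (split Γ G x) = MonoidHom.id _ from DFunLike.congr_fun this s
  refine hom_ext fun y a => ?_
  rw [MonoidHom.comp_apply, MonoidHom.id_apply]
  by_cases h : y = x
  · subst h
    rw [split_of_self, unsplit, SemidirectProduct.lift_inl, conjProductHom_conjOf]
    simp
  · rw [split_of_ne h, unsplit, SemidirectProduct.lift_inr, MonoidHom.id_apply]

/-- The letter from `G x` at the beginning of a reduced word for `s`, or `1` if no reduced word
for `s` begins with a letter from `G x`. -/
noncomputable def front (x : V) (s : GraphProduct Γ G) : G x :=
  CoprodI.head ((1 : GraphProduct Γ G) : GraphProduct Γ G ⧸ link Γ G x) (split Γ G x s).left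

theorem front_one (x : V) : front x (1 : GraphProduct Γ G) = 1 := by
  rw [front, map_one]
  exact CoprodI.head_one _

theorem front_of_mul (x : V) (a : G x) (s : GraphProduct Γ G) :
    front x (of Γ G x a * s) = a * front x s := by
  rw [front, map_mul, split_of_self, SemidirectProduct.mul_left, SemidirectProduct.left_inl,
    SemidirectProduct.right_inl, map_one]
  exact CoprodI.head_of_mul _ _ _

/-- An element of the link acts on the free product by permuting the copies and fixes the base
index, so the head at that index survives. -/
theorem front_link_mul {x : V} {l : GraphProduct Γ G} (hl : l ∈ link Γ G x)
    (s : GraphProduct Γ G) : front x (l * s) = front x s := by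
  rw [front, map_mul, split_of_mem_link hl, SemidirectProduct.mul_left,
    SemidirectProduct.left_inr, SemidirectProduct.right_inr, one_mul]
  have h1 := CoprodI.head_reindex (MulAction.toPermHom _ (GraphProduct Γ G ⧸ link Γ G x) l)
    (split Γ G x s).left (1 : GraphProduct Γ G)
  have h2 : MulAction.toPermHom _ (GraphProduct Γ G ⧸ link Γ G x) l (1 : GraphProduct Γ G) =
    (1 : GraphProduct Γ G) := smul_coe_one_eq_iff.mpr hl
  rw [h2] at h1
  exact h1

theorem front_of_mul_link {x : V} (a : G x) {l : GraphProduct Γ G} (hl : l ∈ link Γ G x) :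
    front x (of Γ G x a * l) = a := by
  rw [front_of_mul, ← mul_one l, front_link_mul hl, front_one, mul_one]

theorem front_of (x : V) (a : G x) : front x (of Γ G x a) = a := by
  rw [← mul_one (of Γ G x a), front_of_mul, front_one, mul_one]

/-- Under `split`, the new letter multiplies the free-product part on the right. By
`CoprodI.head_mul_of` it must lie in the base copy, which puts the semidirect part of `s` in the
link, and the old free-product part must be a single base letter. Applying `unsplit` recovers `s`.
-/
theorem eq_of_front_mul_of_ne {x y : V} {s : GraphProduct Γ G} {a : G y}
    (h : front x (s * of Γ G y a) ≠ front x s) :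
    y = x ∧ ∃ c : G x, ∃ l ∈ link Γ G x, s = of Γ G x c * l := by
  rw [front, front, map_mul, SemidirectProduct.mul_left] at h
  by_cases hyx : y = x
  · subst hyx
    rw [split_of_self, SemidirectProduct.left_inl, conjAction_conjOf] at h
    obtain ⟨h1, c, h2⟩ := CoprodI.head_mul_of h
    refine ⟨rfl, c, _, smul_coe_one_eq_iff.mp h1, ?_⟩
    have h3 : split Γ G y s = SemidirectProduct.inl (split Γ G y s).left *
      SemidirectProduct.inr (split Γ G y s).right :=
      (SemidirectProduct.inl_left_mul_inr_right _).symm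
    have h4 := congrArg (unsplit Γ G y) h3
    rw [unsplit_split, map_mul, h2, unsplit, SemidirectProduct.lift_inl,
      SemidirectProduct.lift_inr, conjProductHom_conjOf] at h4
    simpa using h4
  · rw [split_of_ne hyx, SemidirectProduct.left_inr, map_one, mul_one] at h
    exact absurd rfl h

/-- A nontrivial element has a reduced word, which begins with some letter. -/
theorem eq_one_of_front_eq_one {s : GraphProduct Γ G} (hs : ∀ x, front x s = 1) : s = 1 := by
  suffices ∀ n (l : List (Σ x, G x)), l.length ≤ n → (∀ x, front x (listProd Γ G l) = 1) →
      listProd Γ G l = 1 by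
    obtain ⟨l, rfl⟩ := exists_listProd Γ G s
    exact this _ l le_rfl hs
  intro n
  induction n with
  | zero =>
    intro l hl _
    rw [List.eq_nil_of_length_eq_zero (Nat.le_zero.mp hl)]
    rfl
  | succ n ih =>
    intro l hl hf
    rcases List.eq_nil_or_concat l with rfl | ⟨l, ⟨y, a⟩, rfl⟩
    · rfl
    rw [List.concat_eq_append] at hl hf ⊢
    rw [listProd_append_singleton] at hf ⊢
    have hln : l.length ≤ n := by simpa using hl
    by_cases h1 : listProd Γ G l = 1
    · rw [h1, one_mul] at hf ⊢
      have := hf y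
      rw [front_of] at this
      rw [this, map_one]
    · obtain ⟨x, hx⟩ : ∃ x, front x (listProd Γ G l) ≠ 1 := by
        by_contra! h
        exact h1 (ih l hln h)
      -- The prefix has a nontrivial front which the last letter destroys, so the prefix is a letter
      -- at `y` times a link element.
      obtain ⟨rfl, c, k, hk, hck⟩ := eq_of_front_mul_of_ne (by rw [hf x]; exact hx.symm)
      have hprod : listProd Γ G l * of Γ G y a = of Γ G y (c * a) * k := by
        rw [hck, mul_assoc, link_commute hk, map_mul, mul_assoc]
      have hca : c * a = 1 := by
        have := hf y
        rwa [hprod, front_of_mul_link _ hk] at this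
      rw [hca, map_one, one_mul] at hprod
      -- The letters at `y` cancel and leave `k`, which is the prefix with its letters at `y`
      -- killed, hence spelled by a word no longer than the prefix.
      obtain ⟨l', hl', hlk⟩ := exists_listProd_kill (Γ := Γ) y l
      rw [hck, map_mul, kill_of_self, one_mul, kill_of_mem_link hk] at hlk
      rw [hprod] at hf ⊢
      rw [← hlk] at hf ⊢
      exact ih l' (hl'.trans hln) hf

end Front

end GraphProduct

/-! ### Walls, separation and word length. -/

namespace GraphProduct

section Wall

variable {V : Type*} (Γ : SimpleGraph V) (G : V → Type*) [∀ x, Group (G x)]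

/-- The subgroup generated by the vertex group at `x` and the vertex groups adjacent to `x`. -/
def starSubgroup (x : V) : Subgroup (GraphProduct Γ G) :=
  Subgroup.closure {s | ∃ y, (y = x ∨ Γ.Adj x y) ∧ ∃ b : G y, of Γ G y b = s}

/-- The walls of the graph product: parallelism classes of cosets of the vertex groups. -/
abbrev Wall : Type _ := Σ x, GraphProduct Γ G ⧸ starSubgroup Γ G x

variable {Γ G}

theorem of_mem_star (x : V) (a : G x) : of Γ G x a ∈ starSubgroup Γ G x :=
  Subgroup.subset_closure ⟨x, Or.inl rfl, a, rfl⟩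

theorem link_le_star (x : V) : link Γ G x ≤ starSubgroup Γ G x :=
  Subgroup.closure_mono fun _ ⟨y, hy, b, hb⟩ => ⟨y, Or.inr hy, b, hb⟩

/-- A function on the graph product is constant on cosets of the star subgroup if it is invariant
under the generators. -/
theorem eq_of_mul_star {x : V} {T : Type*} {F : GraphProduct Γ G → T}
    (h1 : ∀ g (a : G x), F (g * of Γ G x a) = F g)
    (h2 : ∀ g y, Γ.Adj x y → ∀ b : G y, F (g * of Γ G y b) = F g)
    {k : GraphProduct Γ G} (hk : k ∈ starSubgroup Γ G x) (g : GraphProduct Γ G) :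
    F (g * k) = F g := by
  induction hk using Subgroup.closure_induction generalizing g with
  | mem k hk =>
    obtain ⟨y, rfl | hy, b, rfl⟩ := hk
    · exact h1 g b
    · exact h2 g y hy b
  | one => rw [mul_one]
  | mul k l _ _ ihk ihl => rw [← mul_assoc, ihl, ihk]
  | inv k _ ih => rw [← ih (g * k⁻¹), inv_mul_cancel_right]

theorem eq_out_of_mul_star {x : V} {T : Type*} {F : GraphProduct Γ G → T}
    (h1 : ∀ g (a : G x), F (g * of Γ G x a) = F g)
    (h2 : ∀ g y, Γ.Adj x y → ∀ b : G y, F (g * of Γ G y b) = F g) (g : GraphProduct Γ G) :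
    F (g : GraphProduct Γ G ⧸ starSubgroup Γ G x).out = F g := by
  obtain ⟨⟨k, hk⟩, h⟩ := QuotientGroup.mk_out_eq_mul (starSubgroup Γ G x) g
  rw [h, eq_of_mul_star h1 h2 hk]

/-- The wall `J` separates `s` and `t`. -/
def Separates (J : Wall Γ G) (s t : GraphProduct Γ G) : Prop :=
  front J.1 (J.2.out⁻¹ * s) ≠ front J.1 (J.2.out⁻¹ * t)

theorem front_mul_of_inv_mul (x : V) (g : GraphProduct Γ G) (a : G x) (s : GraphProduct Γ G) :
    front x ((g * of Γ G x a)⁻¹ * s) = a⁻¹ * front x (g⁻¹ * s) := by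
  rw [mul_inv_rev, mul_assoc, ← map_inv, front_of_mul]

theorem front_mul_link_inv_mul {x y : V} (h : Γ.Adj x y) (g : GraphProduct Γ G) (b : G y)
    (s : GraphProduct Γ G) :
    front x ((g * of Γ G y b)⁻¹ * s) = front x (g⁻¹ * s) := by
  rw [mul_inv_rev, mul_assoc, ← map_inv, front_link_mul (of_mem_link h _)]

/-- Moving `g` within its star coset shifts both fronts by a common left factor or leaves them
alone, so whether they agree does not change. -/
theorem separates_mk_iff {x : V} {g s t : GraphProduct Γ G} :
    Separates ⟨x, g⟩ s t ↔ front x (g⁻¹ * s) ≠ front x (g⁻¹ * t) := by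
  refine iff_of_eq (eq_out_of_mul_star (x := x)
    (F := fun g => front x (g⁻¹ * s) ≠ front x (g⁻¹ * t)) ?_ ?_ g)
  · intro g a
    simp only [front_mul_of_inv_mul, ne_eq, mul_right_inj]
  · intro g y h b
    simp only [front_mul_link_inv_mul h]

theorem separates_smul_iff {J : Wall Γ G} {g s t : GraphProduct Γ G} :
    Separates (g • J) (g * s) (g * t) ↔ Separates J s t := by
  obtain ⟨x, q⟩ := J
  obtain ⟨k, rfl⟩ := QuotientGroup.mk_surjective q
  have : g • (⟨x, (k : GraphProduct Γ G ⧸ starSubgroup Γ G x)⟩ : Wall Γ G) =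
    ⟨x, ((g * k : GraphProduct Γ G) : GraphProduct Γ G ⧸ starSubgroup Γ G x)⟩ := rfl
  rw [this, separates_mk_iff, separates_mk_iff]
  simp only [mul_inv_rev, mul_assoc, inv_mul_cancel_left]

theorem Separates.or {J : Wall Γ G} {s t : GraphProduct Γ G} (h : Separates J s t)
    (r : GraphProduct Γ G) : Separates J s r ∨ Separates J r t := by
  by_contra! h'
  exact h ((not_not.mp h'.1).trans (not_not.mp h'.2))

/-- A change of front under a right letter forces `g⁻¹ = c * l` with `l` in the link, so `g` is in
the star subgroup: a letter crosses only its own wall. -/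
theorem Separates.eq_mk_one {J : Wall Γ G} {x : V} {a : G x}
    (h : Separates J 1 (of Γ G x a)) : J = ⟨x, (1 : GraphProduct Γ G)⟩ := by
  obtain ⟨y, q⟩ := J
  obtain ⟨g, rfl⟩ := QuotientGroup.mk_surjective q
  rw [separates_mk_iff, mul_one] at h
  obtain ⟨rfl, c, l, hl, hg⟩ := eq_of_front_mul_of_ne h.symm
  congr 1
  refine (QuotientGroup.eq.mpr ?_)
  rw [mul_one, hg]
  exact mul_mem (of_mem_star _ _) (link_le_star _ hl)

variable (Γ G) in
/-- The set of the walls that separate `s` and `t`. -/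
def separating (s t : GraphProduct Γ G) : Set (Wall Γ G) := {J | Separates J s t}

theorem separating_mul (g s t : GraphProduct Γ G) :
    separating Γ G (g * s) (g * t) = (fun J => g • J) '' separating Γ G s t := by
  ext J
  constructor
  · intro h
    refine ⟨g⁻¹ • J, ?_, smul_inv_smul g J⟩
    rw [separating, Set.mem_ofPred_eq, ← separates_smul_iff (g := g), smul_inv_smul]
    exact h
  · rintro ⟨J, h, rfl⟩
    exact separates_smul_iff.mpr h

theorem separating_finite (s t : GraphProduct Γ G) : (separating Γ G s t).Finite := by
  have key : ∀ s, (separating Γ G 1 s).Finite := by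
    intro s
    induction s using induction_right with
    | one => exact Set.finite_empty.subset fun J h => h rfl
    | mul s x a ih =>
      have h1 : (separating Γ G s (s * of Γ G x a)).Finite := by
        have := separating_mul s 1 (of Γ G x a)
        rw [mul_one] at this
        rw [this]
        exact ((Set.finite_singleton _).subset fun J h => Separates.eq_mk_one h).image _
      exact (ih.union h1).subset fun J h => Separates.or h s
  have := separating_mul s 1 (s⁻¹ * t)
  rw [mul_one, mul_inv_cancel_left] at this
  rw [this]
  exact (key _).image _

theorem eq_one_of_separating_eq_empty {s : GraphProduct Γ G} (h : separating Γ G 1 s = ∅) :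
    s = 1 := by
  refine eq_one_of_front_eq_one fun x => ?_
  have : ¬ Separates ⟨x, (1 : GraphProduct Γ G)⟩ 1 s := fun h' => by
    have : _ ∈ separating Γ G 1 s := h'
    simp [h] at this
  rw [separates_mk_iff, not_not] at this
  simpa [front_one] using this.symm

theorem not_separates_front (x : V) (s : GraphProduct Γ G) :
    ¬ Separates ⟨x, (1 : GraphProduct Γ G)⟩ (of Γ G x (front x s)) s := by
  rw [separates_mk_iff, not_not]
  simp [front_of]

theorem not_separates_one_of {x : V} {a : G x} {J : Wall Γ G}
    (h : J ≠ ⟨x, (1 : GraphProduct Γ G)⟩) : ¬ Separates J 1 (of Γ G x a) :=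
  fun h' => h h'.eq_mk_one

/-- The front letter crosses its own wall, and the other walls are a translate of those for the
remaining word. The count thus serves as word length. -/
theorem ncard_separating_of_front_ne_one {x : V} {s : GraphProduct Γ G} (h : front x s ≠ 1) :
    (separating Γ G 1 s).ncard =
      (separating Γ G 1 ((of Γ G x (front x s))⁻¹ * s)).ncard + 1 := by
  set a := of Γ G x (front x s) with ha
  have h1 : separating Γ G 1 s = insert ⟨x, (1 : GraphProduct Γ G)⟩ (separating Γ G a s) := by
    ext J
    by_cases hJ : J = ⟨x, (1 : GraphProduct Γ G)⟩
    · subst hJ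
      refine iff_of_true ?_ (Or.inl rfl)
      rw [separating, Set.mem_ofPred_eq, separates_mk_iff]
      simpa [front_one] using h.symm
    · have h2 : front J.1 _ = front J.1 _ := not_not.mp (not_separates_one_of (a := front x s) hJ)
      simp only [separating, Set.mem_insert_iff, hJ, false_or, Set.mem_ofPred_eq, Separates, h2]
      exact Iff.rfl
  have h2 := separating_mul a 1 (a⁻¹ * s)
  rw [mul_one, mul_inv_cancel_left] at h2
  rw [h1, Set.ncard_insert_of_notMem (not_separates_front x s) (separating_finite _ _), h2,
    Set.ncard_image_of_injective _ (MulAction.injective a)]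

end Wall

/-! ### The product of the wall kernels, with values in a commutative monoid. -/

section Kernel

variable {V : Type*} {Γ : SimpleGraph V} {G : V → Type*} [∀ x, Group (G x)]
  {Z : Type*} [CommMonoid Z] (β : GraphProduct Γ G →* MulAut Z) (h : ∀ x, G x → Z)

/-- The kernel that a multiplier on the vertex group at `x` induces on the graph product, by
projecting to the coset `g * G x`. -/
noncomputable def panelKernel (x : V) (s t g : GraphProduct Γ G) : Z :=
  β (g * of Γ G x (front x (g⁻¹ * t))) (h x ((front x (g⁻¹ * s))⁻¹ * front x (g⁻¹ * t)))

/-- The kernel of the panels in the class `J`. -/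
noncomputable def wallKernel (J : Wall Γ G) (s t : GraphProduct Γ G) : Z :=
  panelKernel β h J.1 s t J.2.out

/-- The product of the wall kernels. -/
noncomputable def prodKernel (s t : GraphProduct Γ G) : Z := ∏ᶠ J, wallKernel β h J s t

variable {β h}

theorem wallKernel_mk
    (hfix : ∀ x y, Γ.Adj x y → ∀ (a : G x) (b : G y), β (of Γ G y b) (h x a) = h x a)
    (x : V) (g s t : GraphProduct Γ G) :
    wallKernel β h ⟨x, g⟩ s t = panelKernel β h x s t g := by
  refine eq_out_of_mul_star (x := x) (F := panelKernel β h x s t) ?_ ?_ g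
  · intro g a
    have h2 : ∀ c d : G x, (a⁻¹ * c)⁻¹ * (a⁻¹ * d) = c⁻¹ * d := fun c d => by group
    have h3 : ∀ c : G x, g * of Γ G x a * of Γ G x (a⁻¹ * c) = g * of Γ G x c := fun c => by
      rw [map_mul, map_inv]
      group
    simp only [panelKernel, front_mul_of_inv_mul, h2, h3]
  · intro g y hy b
    simp only [panelKernel, front_mul_link_inv_mul hy]
    -- Commutation of the multipliers enters here: `b` is moved past the letter at `x` and then
    -- fixes the value of `h x`.
    rw [mul_assoc, ← of_commute hy, ← mul_assoc, map_mul, MulAut.mul_apply, hfix x y hy]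

theorem wallKernel_smul
    (hfix : ∀ x y, Γ.Adj x y → ∀ (a : G x) (b : G y), β (of Γ G y b) (h x a) = h x a)
    (J : Wall Γ G) (g s t : GraphProduct Γ G) :
    wallKernel β h (g • J) (g * s) (g * t) = β g (wallKernel β h J s t) := by
  obtain ⟨x, q⟩ := J
  obtain ⟨k, rfl⟩ := QuotientGroup.mk_surjective q
  have : g • (⟨x, (k : GraphProduct Γ G ⧸ starSubgroup Γ G x)⟩ : Wall Γ G) =
    ⟨x, ((g * k : GraphProduct Γ G) : GraphProduct Γ G ⧸ starSubgroup Γ G x)⟩ := rfl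
  rw [this, wallKernel_mk hfix, wallKernel_mk hfix]
  simp only [panelKernel, mul_inv_rev, mul_assoc, inv_mul_cancel_left]
  rw [map_mul β g, MulAut.mul_apply]

theorem wallKernel_eq_one (h1 : ∀ x, h x 1 = 1) {J : Wall Γ G} {s t : GraphProduct Γ G}
    (hJ : ¬ Separates J s t) : wallKernel β h J s t = 1 := by
  rw [wallKernel, panelKernel, not_not.mp hJ, inv_mul_cancel, h1, map_one]

theorem mulSupport_wallKernel_subset (h1 : ∀ x, h x 1 = 1) (s t : GraphProduct Γ G) :
    Function.mulSupport (fun J => wallKernel β h J s t) ⊆ separating Γ G s t := by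
  intro J hJ
  by_contra h'
  exact hJ (wallKernel_eq_one h1 h')

theorem mulSupport_wallKernel_finite (h1 : ∀ x, h x 1 = 1) (s t : GraphProduct Γ G) :
    (Function.mulSupport (fun J => wallKernel β h J s t)).Finite :=
  (separating_finite s t).subset (mulSupport_wallKernel_subset h1 s t)

theorem prodKernel_mul (h1 : ∀ x, h x 1 = 1)
    (hfix : ∀ x y, Γ.Adj x y → ∀ (a : G x) (b : G y), β (of Γ G y b) (h x a) = h x a)
    (g s t : GraphProduct Γ G) :
    prodKernel β h (g * s) (g * t) = β g (prodKernel β h s t) := by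
  rw [prodKernel, prodKernel]
  refine (finprod_comp_equiv (MulAction.toPerm g)).symm.trans ?_
  refine Eq.trans ?_ ((β g).toMonoidHom.map_finprod (mulSupport_wallKernel_finite h1 s t)).symm
  exact finprod_congr fun J => wallKernel_smul hfix J g s t

theorem prodKernel_eq_prod (h1 : ∀ x, h x 1 = 1) {s t : GraphProduct Γ G}
    {T : Finset (Wall Γ G)} (hT : separating Γ G s t ⊆ T) :
    prodKernel β h s t = ∏ J ∈ T, wallKernel β h J s t :=
  finprod_eq_prod_of_mulSupport_subset _ ((mulSupport_wallKernel_subset h1 s t).trans hT)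

theorem prodKernel_one_of (h1 : ∀ x, h x 1 = 1)
    (hfix : ∀ x y, Γ.Adj x y → ∀ (a : G x) (b : G y), β (of Γ G y b) (h x a) = h x a)
    (x : V) (a : G x) :
    prodKernel β h 1 (of Γ G x a) = β (of Γ G x a) (h x a) := by
  rw [prodKernel_eq_prod h1 (T := {⟨x, (1 : GraphProduct Γ G)⟩})
    (fun J h => by simpa using Separates.eq_mk_one h), Finset.prod_singleton,
    wallKernel_mk hfix]
  simp [panelKernel, front_one, front_of]

/-- The base wall at `x` sees no difference between the front letter and `s`, and every other wall
sees none between `1` and the front letter; so each wall contributes to one factor only. -/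
theorem prodKernel_one_eq_mul (h1 : ∀ x, h x 1 = 1) (x : V) (s : GraphProduct Γ G) :
    prodKernel β h 1 s =
      prodKernel β h 1 (of Γ G x (front x s)) * prodKernel β h (of Γ G x (front x s)) s := by
  rw [prodKernel, prodKernel, prodKernel, ← finprod_mul_distrib
    (mulSupport_wallKernel_finite h1 _ _) (mulSupport_wallKernel_finite h1 _ _)]
  refine finprod_congr fun J => ?_
  by_cases hJ : J = ⟨x, (1 : GraphProduct Γ G)⟩
  · subst hJ
    have h2 := not_separates_front x s
    rw [wallKernel_eq_one h1 h2, mul_one, wallKernel, wallKernel, panelKernel, panelKernel,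
      not_not.mp h2]
  · have h2 := not_separates_one_of (a := front x s) hJ
    rw [wallKernel_eq_one h1 h2, one_mul, wallKernel, wallKernel, panelKernel, panelKernel,
      not_not.mp h2]

end Kernel

end GraphProduct

/-! ### Automorphisms acting on the centre, and norms. -/

section Center

variable {A : Type*} [CStarAlgebra A]

/-- The action of the automorphism group of a C⋆-algebra on its centre. -/
def centerAut (A : Type*) [CStarAlgebra A] : (A ≃⋆ₐ[ℂ] A) →* MulAut (Submonoid.center A) where
  toFun e := Submonoid.centerCongr (e : A ≃* A)
  map_one' := rfl
  map_mul' _ _ := rfl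

theorem coe_centerAut (e : A ≃⋆ₐ[ℂ] A) (z : Submonoid.center A) :
    (centerAut A e z : A) = e z := rfl

theorem StarAlgEquiv.norm_apply (e : A ≃⋆ₐ[ℂ] A) (a : A) : ‖e a‖ = ‖a‖ :=
  NonUnitalStarAlgHom.norm_map (e : A →⋆ₐ[ℂ] A) e.injective a

theorem CStarAlgebra.norm_one_le_one : ‖(1 : A)‖ ≤ 1 := by
  rcases subsingleton_or_nontrivial A with _ | _
  · simp [Subsingleton.elim (1 : A) 0]
  · exact CStarRing.norm_one.le

end Center

/-! ### Positivity, convergence and decay of the central kernel. -/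

namespace GraphProduct

variable {V : Type*} {Γ : SimpleGraph V} {G : V → Type*} [∀ x, Group (G x)]
  {A : Type*} [CStarAlgebra A]

theorem graphProductAction_of {α : ∀ x, G x →* (A ≃⋆ₐ[ℂ] A)} (hα : ActionsCommute Γ α) (x : V)
    (a : G x) : graphProductAction Γ α hα (of Γ G x a) = α x a :=
  lift_of Γ α hα x a

/-- The kernel on the graph product induced by central-valued functions on the vertex groups. -/
noncomputable def centerKernel (β : GraphProduct Γ G →* (A ≃⋆ₐ[ℂ] A))
    (h : ∀ x, G x → Submonoid.center A) (s t : GraphProduct Γ G) : Submonoid.center A :=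
  prodKernel ((centerAut A).comp β) h s t

variable {β : GraphProduct Γ G →* (A ≃⋆ₐ[ℂ] A)} {h : ∀ x, G x → Submonoid.center A}

theorem centerKernel_mul (h1 : ∀ x, h x 1 = 1)
    (hfix : ∀ x y, Γ.Adj x y → ∀ (a : G x) (b : G y),
      β (of Γ G y b) (h x a : A) = h x a) (g s t : GraphProduct Γ G) :
    (centerKernel β h (g * s) (g * t) : A) = β g (centerKernel β h s t) :=
  congrArg Subtype.val
    (prodKernel_mul h1 (fun x y hxy a b => Subtype.ext (hfix x y hxy a b)) g s t)

theorem isPosKernel_centerKernel [PartialOrder A] [StarOrderedRing A] (h1 : ∀ x, h x 1 = 1)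
    (hpos : ∀ x, IsPosKernel fun a b : G x => β (of Γ G x b) (h x (a⁻¹ * b) : A)) :
    IsPosKernel fun s t => (centerKernel β h s t : A) := by
  have hwall : ∀ J : Wall Γ G, IsPosKernel fun s t =>
      ((wallKernel ((centerAut A).comp β) h J s t : Submonoid.center A) : A) := by
    rintro ⟨x, q⟩
    have := ((hpos x).map (β q.out : A →⋆ₐ[ℂ] A)).comp fun s => front x (q.out⁻¹ * s)
    convert this using 3 with s t
    simp only [wallKernel, panelKernel, MonoidHom.comp_apply, coe_centerAut, map_mul β]
    rfl
  have hprod : ∀ T : Finset (Wall Γ G), IsPosKernel fun s t =>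
      ((∏ J ∈ T, wallKernel ((centerAut A).comp β) h J s t : Submonoid.center A) : A) := by
    classical
    intro T
    induction T using Finset.induction_on with
    | empty => simpa using IsPosKernel.one
    | insert J T hJ ih =>
      simp only [Finset.prod_insert hJ, Submonoid.coe_mul]
      exact (hwall J).mul ih fun s t => Subtype.property _
  intro n x
  -- Finitely many walls separate the given points pairwise, so the whole matrix is one finite Schur
  -- product.
  have hfin : (⋃ i, ⋃ j, separating Γ G (x i) (x j)).Finite :=
    Set.finite_iUnion fun i => Set.finite_iUnion fun j => separating_finite _ _
  convert hprod hfin.toFinset n x using 5 with i j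
  refine congrArg Subtype.val (prodKernel_eq_prod h1 ?_)
  rw [hfin.coe_toFinset]
  exact Set.subset_iUnion₂_of_subset i j le_rfl

theorem tendsto_centerKernel {h : ℕ → ∀ x, G x → Submonoid.center A} (h1 : ∀ n x, h n x 1 = 1)
    (hlim : ∀ x a, Tendsto (fun n => (h n x a : A)) atTop (𝓝 1)) (s t : GraphProduct Γ G) :
    Tendsto (fun n => (centerKernel β (h n) s t : A)) atTop (𝓝 1) := by
  have key : Tendsto (fun n => centerKernel β (h n) s t) atTop (𝓝 1) := by
    have h2 : ∀ n, centerKernel β (h n) s t = ∏ J ∈ (separating_finite s t).toFinset,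
        wallKernel ((centerAut A).comp β) (h n) J s t := fun n =>
      prodKernel_eq_prod (h1 n) (by rw [Set.Finite.coe_toFinset])
    simp only [h2]
    rw [← Finset.prod_const_one (s := (separating_finite s t).toFinset)]
    refine tendsto_finsetProd _ fun J _ => tendsto_subtype_rng.mpr ?_
    have hcont : ∀ e : A ≃⋆ₐ[ℂ] A, Continuous e := fun e =>
      (AddMonoidHomClass.isometry_of_norm e fun a => e.norm_apply a).continuous
    have := ((hcont (β (J.2.out * of Γ G J.1 (front J.1 (J.2.out⁻¹ * t))))).tendsto 1).comp
      (hlim J.1 ((front J.1 (J.2.out⁻¹ * s))⁻¹ * front J.1 (J.2.out⁻¹ * t)))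
    rw [map_one] at this
    exact this
  exact tendsto_subtype_rng.mp key

theorem norm_centerKernel_one (h1 : ∀ x, h x 1 = 1)
    (hfix : ∀ x y, Γ.Adj x y → ∀ (a : G x) (b : G y),
      β (of Γ G y b) (h x a : A) = h x a) (x : V) (s : GraphProduct Γ G) :
    ‖(centerKernel β h 1 s : A)‖ ≤ ‖(h x (front x s) : A)‖ *
      ‖(centerKernel β h 1 ((of Γ G x (front x s))⁻¹ * s) : A)‖ := by
  have h2 : (centerKernel β h 1 s : A) = β (of Γ G x (front x s)) (h x (front x s)) *
      centerKernel β h (of Γ G x (front x s)) s := by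
    have h3 := prodKernel_one_eq_mul (β := (centerAut A).comp β) h1 x s
    rw [prodKernel_one_of h1 (fun x y hxy a b => Subtype.ext (hfix x y hxy a b))] at h3
    exact congrArg Subtype.val h3
  have h4 := centerKernel_mul h1 hfix (of Γ G x (front x s)) 1 ((of Γ G x (front x s))⁻¹ * s)
  rw [mul_one, mul_inv_cancel_left] at h4
  rw [h2, h4]
  refine (norm_mul_le _ _).trans (le_of_eq ?_)
  rw [StarAlgEquiv.norm_apply, StarAlgEquiv.norm_apply]

theorem exists_front_ne_one {s : GraphProduct Γ G} {n : ℕ}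
    (hs : (separating Γ G 1 s).ncard = n + 1) : ∃ x, front x s ≠ 1 := by
  by_contra! h'
  rw [eq_one_of_front_eq_one h'] at hs
  have : separating Γ G 1 1 = ∅ := Set.eq_empty_of_forall_notMem fun J hJ => hJ rfl
  simp [this] at hs

theorem norm_centerKernel_le (h1 : ∀ x, h x 1 = 1)
    (hfix : ∀ x y, Γ.Adj x y → ∀ (a : G x) (b : G y),
      β (of Γ G y b) (h x a : A) = h x a)
    {ρ : ℝ} (hρ : ∀ x (a : G x), a ≠ 1 → ‖(h x a : A)‖ ≤ ρ) (n : ℕ) (s : GraphProduct Γ G)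
    (hs : (separating Γ G 1 s).ncard = n) : ‖(centerKernel β h 1 s : A)‖ ≤ ρ ^ n := by
  induction n generalizing s with
  | zero =>
    rw [Set.ncard_eq_zero (separating_finite _ _)] at hs
    have : centerKernel β h 1 s = 1 := by
      rw [centerKernel, prodKernel_eq_prod h1 (T := ∅) (by simp [hs]), Finset.prod_empty]
    rw [this, pow_zero]
    exact CStarAlgebra.norm_one_le_one
  | succ n ih =>
    obtain ⟨x, hx⟩ := exists_front_ne_one hs
    have h2 := ncard_separating_of_front_ne_one hx
    refine (norm_centerKernel_one h1 hfix x s).trans ?_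
    rw [pow_succ']
    exact mul_le_mul (hρ x _ hx) (ih _ (by omega)) (norm_nonneg _)
      ((norm_nonneg _).trans (hρ x _ hx))

/-- The bound `ρ ^ n` limits the length. At fixed length all factors are at most `1`, so both the
front letter and the rest must reach `ε`, and induction on the length applies. -/
theorem finite_le_norm_centerKernel (h1 : ∀ x, h x 1 = 1)
    (hfix : ∀ x y, Γ.Adj x y → ∀ (a : G x) (b : G y),
      β (of Γ G y b) (h x a : A) = h x a)
    {ρ : ℝ} (hρ0 : 0 ≤ ρ) (hρ1 : ρ < 1) (hρ : ∀ x (a : G x), a ≠ 1 → ‖(h x a : A)‖ ≤ ρ)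
    {ε : ℝ} (hε : 0 < ε)
    (hfin : {p : Σ x, G x | p.2 ≠ 1 ∧ ε ≤ ‖(h p.1 p.2 : A)‖}.Finite) :
    {s | ε ≤ ‖(centerKernel β h 1 s : A)‖}.Finite := by
  have key : ∀ n, {s | (separating Γ G 1 s).ncard = n ∧
      ε ≤ ‖(centerKernel β h 1 s : A)‖}.Finite := by
    intro n
    induction n with
    | zero =>
      refine (Set.finite_singleton 1).subset fun s hs => ?_
      exact eq_one_of_separating_eq_empty
        ((Set.ncard_eq_zero (separating_finite _ _)).mp hs.1)
    | succ n ih =>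
      refine (hfin.image2 (fun p s => of Γ G p.1 p.2 * s) ih).subset ?_
      rintro s ⟨hs, hsε⟩
      obtain ⟨x, hx⟩ := exists_front_ne_one hs
      have h2 := ncard_separating_of_front_ne_one hx
      have h3 := hsε.trans (norm_centerKernel_one h1 hfix x s)
      have h4 : ‖(h x (front x s) : A)‖ ≤ 1 := (hρ x _ hx).trans hρ1.le
      have h5 : ‖(centerKernel β h 1 ((of Γ G x (front x s))⁻¹ * s) : A)‖ ≤ 1 :=
        (norm_centerKernel_le h1 hfix hρ _ _ rfl).trans (pow_le_one₀ hρ0 hρ1.le)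
      refine ⟨⟨x, front x s⟩, ⟨hx, h3.trans ?_⟩, (of Γ G x (front x s))⁻¹ * s,
        ⟨by omega, h3.trans ?_⟩, mul_inv_cancel_left _ _⟩
      · exact mul_le_of_le_one_right (norm_nonneg _) h5
      · exact mul_le_of_le_one_left (norm_nonneg _) h4
  obtain ⟨N, hN⟩ := exists_pow_lt_of_lt_one hε hρ1
  refine ((Set.finite_Iio N).biUnion fun n _ => key n).subset fun s hs => ?_
  refine Set.mem_biUnion (x := (separating Γ G 1 s).ncard) ?_ ⟨rfl, hs⟩
  by_contra h'
  have h2 : ‖(centerKernel β h 1 s : A)‖ ≤ ρ ^ N :=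
    (norm_centerKernel_le h1 hfix hρ _ _ rfl).trans
      (pow_le_pow_of_le_one hρ0 hρ1.le (not_lt.mp h'))
  exact absurd (hs.trans h2) (not_le.mpr hN)

/-- The graph product of multipliers that are normalised and uniformly small off the identity. -/
theorem haagerupProperty_of_normalised [PartialOrder A] [StarOrderedRing A]
    (h : ℕ → ∀ x, G x → Submonoid.center A) (h1 : ∀ n x, h n x 1 = 1)
    (hfix : ∀ n x y, Γ.Adj x y → ∀ (a : G x) (b : G y),
      β (of Γ G y b) (h n x a : A) = h n x a)
    (hpos : ∀ n x, IsPosKernel fun a b : G x => β (of Γ G x b) (h n x (a⁻¹ * b) : A))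
    (hlim : ∀ x a, Tendsto (fun n => (h n x a : A)) atTop (𝓝 1))
    (hρ : ∀ n, ∃ ρ : ℝ, 0 ≤ ρ ∧ ρ < 1 ∧ ∀ x (a : G x), a ≠ 1 → ‖(h n x a : A)‖ ≤ ρ)
    (hfin : ∀ n, ∀ ε : ℝ, 0 < ε →
      {p : Σ x, G x | p.2 ≠ 1 ∧ ε ≤ ‖(h n p.1 p.2 : A)‖}.Finite) :
    HaagerupProperty β := by
  have hinv : ∀ n s, (centerKernel β (h n) s⁻¹ 1 : A) = β s⁻¹ (centerKernel β (h n) 1 s) := by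
    intro n s
    have := centerKernel_mul (h1 n) (hfix n) s⁻¹ 1 s
    rwa [mul_one, inv_mul_cancel] at this
  -- By equivariance, `β (x j)` applied to the value of this multiplier at `(x i)⁻¹ * x j` is the
  -- kernel at `(x i, x j)`.
  refine ⟨fun n s => centerKernel β (h n) s⁻¹ 1, fun n => ⟨fun s => Subtype.property _, ?_⟩,
    fun n ε hε => ?_, fun s => tendsto_centerKernel h1 hlim _ _⟩
  · intro m x
    convert isPosKernel_centerKernel (h1 n) (hpos n) m x using 5 with i j
    have := centerKernel_mul (h1 n) (hfix n) (x j) ((x i)⁻¹ * x j)⁻¹ 1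
    rw [← this]
    congr 2 <;> group
  · obtain ⟨ρ, hρ0, hρ1, hρ⟩ := hρ n
    have hF := finite_le_norm_centerKernel (h1 n) (hfix n) hρ0 hρ1 hρ hε (hfin n ε hε)
    refine ⟨hF.toFinset, fun s hs => ?_⟩
    rw [hinv, StarAlgEquiv.norm_apply]
    simpa using hs

end GraphProduct

/-! ### Normalising a multiplier at the identity. -/

section Normalise

variable {H : Type*} [Group H] {A : Type*} [CStarAlgebra A]

open Classical in
/-- Scale a multiplier by `r` and reset its value at the identity to `1`. -/
noncomputable def normalise (r : ℝ) (h : H → A) (a : H) : A := if a = 1 then 1 else r • h a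

theorem normalise_one (r : ℝ) (h : H → A) : normalise r h 1 = 1 := if_pos rfl

theorem normalise_of_ne {r : ℝ} {h : H → A} {a : H} (ha : a ≠ 1) : normalise r h a = r • h a :=
  if_neg ha

theorem StarAlgEquiv.map_real_smul (e : A ≃⋆ₐ[ℂ] A) (r : ℝ) (a : A) : e (r • a) = r • e a := by
  rw [← Complex.coe_smul, map_smul, Complex.coe_smul]

theorem map_normalise {e : A ≃⋆ₐ[ℂ] A} {r : ℝ} {h : H → A} {a : H} (he : e (h a) = h a) :
    e (normalise r h a) = normalise r h a := by
  by_cases ha : a = 1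
  · rw [ha, normalise_one, map_one]
  · rw [normalise_of_ne ha, e.map_real_smul, he]

variable [PartialOrder A] [StarOrderedRing A] {α : H →* (A ≃⋆ₐ[ℂ] A)} {h : H → A}

theorem IsPosDefMultiplier.isPosKernel (hh : IsPosDefMultiplier α h) :
    IsPosKernel fun a b => α b (h (a⁻¹ * b)) := hh.posDef

theorem IsPosKernel.nonneg_diag {X : Type*} {K : X → X → A} (hK : IsPosKernel K) (x : X) :
    0 ≤ K x x := by
  obtain ⟨d, hd⟩ := CStarMatrix.exists_gram_of_nonneg (hK 1 fun _ => x)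
  have h0 : K x x = _ := hd 0 0
  rw [h0]
  exact Finset.sum_nonneg fun k _ => star_mul_self_nonneg _

namespace IsPosDefMultiplier

theorem one_nonneg (hh : IsPosDefMultiplier α h) : 0 ≤ h 1 := by
  simpa using hh.isPosKernel.nonneg_diag 1

/-- Cauchy–Schwarz for the points `1` and `a`, since automorphisms are isometric. -/
theorem norm_le (hh : IsPosDefMultiplier α h) (a : H) : ‖h a‖ ≤ ‖h 1‖ := by
  have := hh.isPosKernel.norm_sq_le 1 a
  simp only [inv_one, one_mul, inv_mul_cancel, StarAlgEquiv.norm_apply] at this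
  rw [← sq] at this
  exact (sq_le_sq₀ (norm_nonneg _) (norm_nonneg _)).mp this

theorem normalise_mem_center (hh : IsPosDefMultiplier α h) (r : ℝ) (a : H) :
    normalise r h a ∈ Set.center A := by
  by_cases ha : a = 1
  · rw [ha, normalise_one]
    exact Set.one_mem_center
  · rw [normalise_of_ne ha]
    exact Set.smul_mem_center r (hh.central a)

/-- Resetting the value at the identity adds a diagonal kernel with entries `α b (1 - r • h 1)`,
nonnegative because `r * ‖h 1‖ ≤ 1`. -/
theorem isPosKernel_normalise (hh : IsPosDefMultiplier α h) {r : ℝ} (hr0 : 0 ≤ r)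
    (hr : r * ‖h 1‖ ≤ 1) : IsPosKernel fun a b => α b (normalise r h (a⁻¹ * b)) := by
  classical
  have hle : r • h 1 ≤ 1 := by
    refine (CStarAlgebra.norm_le_one_iff_of_nonneg _ (smul_nonneg hr0 hh.one_nonneg)).mp ?_
    rwa [norm_smul, Real.norm_of_nonneg hr0]
  have hd : ∀ b, 0 ≤ α b (1 - r • h 1) := fun b => map_nonneg (α b) (sub_nonneg.mpr hle)
  convert (hh.isPosKernel.smul hr0).add (IsPosKernel.diagonal hd) using 3 with a b
  by_cases hab : a = b
  · subst hab
    simp [normalise_one, StarAlgEquiv.map_real_smul]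
  · have : a⁻¹ * b ≠ 1 := by rwa [ne_eq, inv_mul_eq_one]
    simp [hab, normalise_of_ne this, StarAlgEquiv.map_real_smul]

end IsPosDefMultiplier

end Normalise

/-! ### Scaling factors. -/

section Scale

variable {A : Type*} [CStarAlgebra A]

/-- A scaling factor, tending to `1` with `n` when `a` does, that makes the norm of `a` at most
`exp (-(m + 1) / (n + 1))`. -/
noncomputable def scale (a : A) (m n : ℕ) : ℝ := Real.exp (-(m + 1) / (n + 1)) / max 1 ‖a‖

theorem scale_nonneg (a : A) (m n : ℕ) : 0 ≤ scale a m n := by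
  unfold scale
  positivity

theorem scale_mul_norm_le (a : A) (m n : ℕ) :
    scale a m n * ‖a‖ ≤ Real.exp (-(m + 1) / (n + 1)) := by
  rw [scale, div_mul_eq_mul_div]
  refine div_le_of_le_mul₀ (by positivity) (by positivity) ?_
  gcongr
  exact le_max_right _ _

theorem scale_le_one (a : A) (m n : ℕ) : scale a m n ≤ 1 := by
  refine div_le_one_of_le₀ (le_trans ?_ (le_max_left _ _)) (by positivity)
  exact Real.exp_le_one_iff.mpr (div_nonpos_of_nonpos_of_nonneg (by linarith) (by positivity))

theorem tendsto_scale {a : ℕ → A} (m : ℕ) (ha : Tendsto a atTop (𝓝 1)) :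
    Tendsto (fun n => scale (a n) m n) atTop (𝓝 1) := by
  have h1 : Tendsto (fun n : ℕ => Real.exp (-((m : ℝ) + 1) / (n + 1))) atTop (𝓝 1) := by
    rw [← Real.exp_zero]
    refine (Real.continuous_exp.tendsto 0).comp ?_
    exact tendsto_const_nhds.div_atTop
      (tendsto_atTop_add_const_right _ _ tendsto_natCast_atTop_atTop)
  have h2 : Tendsto (fun n => max 1 ‖a n‖) atTop (𝓝 1) := by
    have := (tendsto_const_nhds (x := (1 : ℝ))).max ha.norm
    rwa [max_eq_left CStarAlgebra.norm_one_le_one] at this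
  have h3 := h1.div h2 one_ne_zero
  rw [div_one] at h3
  exact h3

theorem exists_nat_exp_lt (n : ℕ) {ε : ℝ} (hε : 0 < ε) :
    ∃ N : ℕ, ∀ m : ℕ, N ≤ m → Real.exp (-(m + 1) / (n + 1)) < ε := by
  have h1 : Tendsto (fun m : ℕ => Real.exp (-((m : ℝ) + 1) / (n + 1))) atTop (𝓝 0) := by
    refine Real.tendsto_exp_atBot.comp ?_
    simp only [neg_div]
    exact tendsto_neg_atTop_atBot.comp ((tendsto_atTop_add_const_right _ _
      tendsto_natCast_atTop_atTop).atTop_div_const (by positivity))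
  exact eventually_atTop.mp (h1.eventually_lt_const hε)

end Scale

theorem theorem5p3 {V : Type*} (Γ : SimpleGraph V) (G : V → Type*) [∀ x, Group (G x)]
    {A : Type*} [CStarAlgebra A] [PartialOrder A] [StarOrderedRing A]
    (hV : {x : V | Nontrivial (G x)}.Countable)
    (α : ∀ x, G x →* (A ≃⋆ₐ[ℂ] A)) (hα : ActionsCommute Γ α)
    (h : ∀ x, ℕ → G x → A) (hwit : ∀ x, WitnessesHaagerup (α x) (h x))
    (hcomm : ∀ n, MultipliersCommute Γ α (fun x => h x n)) :
    HaagerupProperty (graphProductAction Γ α hα) := by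
  obtain ⟨f, hf⟩ := Set.countable_iff_exists_injOn.mp hV
  -- For fixed `n` the resulting bound is at most `exp (-1 / (n + 1)) < 1` and tends to `0` along
  -- the enumeration `f`; for a fixed vertex the factor tends to `1` with `n`.
  let r : ℕ → V → ℝ := fun n x => scale (h x n 1) (f x) n
  have hr0 : ∀ n x, 0 ≤ r n x := fun n x => scale_nonneg _ _ _
  have hr : ∀ n x, r n x * ‖h x n 1‖ ≤ Real.exp (-(f x + 1) / (n + 1)) :=
    fun n x => scale_mul_norm_le _ _ _
  have hexp : ∀ (n : ℕ) x, Real.exp (-(f x + 1) / (n + 1)) ≤ Real.exp (-1 / (n + 1)) :=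
      fun n x => by
    refine Real.exp_le_exp.mpr (div_le_div_of_nonneg_right ?_ (by positivity))
    linarith [(f x).cast_nonneg (α := ℝ)]
  have hexp1 : ∀ n : ℕ, Real.exp (-1 / (n + 1)) < 1 := fun n =>
    Real.exp_lt_one_iff.mpr (div_neg_of_neg_of_pos (by norm_num) n.cast_add_one_pos)
  have hnorm : ∀ n x (a : G x), a ≠ 1 →
      ‖normalise (r n x) (h x n) a‖ ≤ Real.exp (-(f x + 1) / (n + 1)) := fun n x a ha => by
    rw [normalise_of_ne ha, norm_smul, Real.norm_of_nonneg (hr0 n x)]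
    exact (mul_le_mul_of_nonneg_left (((hwit x).multiplier n).norm_le a) (hr0 n x)).trans (hr n x)
  refine GraphProduct.haagerupProperty_of_normalised
    (fun n x a => ⟨normalise (r n x) (h x n) a,
      ((hwit x).multiplier n).normalise_mem_center (r n x) a⟩)
    (fun n x => Subtype.ext (normalise_one _ _)) ?_ ?_ ?_ ?_ ?_
  · intro n x y hxy a b
    rw [GraphProduct.graphProductAction_of]
    exact map_normalise (hcomm n x y hxy a b).2
  · intro n x
    simp only [GraphProduct.graphProductAction_of]
    exact ((hwit x).multiplier n).isPosKernel_normalise (hr0 n x)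
      ((hr n x).trans ((hexp n x).trans (hexp1 n).le))
  · intro x a
    by_cases ha : a = 1
    · simp only [ha, normalise_one, tendsto_const_nhds]
    · simp only [normalise_of_ne ha]
      rw [← one_smul ℝ (1 : A)]
      exact (tendsto_scale (f x) ((hwit x).tendsto_one 1)).smul ((hwit x).tendsto_one a)
  · intro n
    exact ⟨Real.exp (-1 / (n + 1)), (Real.exp_pos _).le, hexp1 n,
      fun x a ha => (hnorm n x a ha).trans (hexp n x)⟩
  · intro n ε hε
    obtain ⟨N, hN⟩ := exists_nat_exp_lt n hε
    have hX : {x : V | Nontrivial (G x) ∧ f x < N}.Finite :=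
      Set.Finite.of_finite_image ((Set.finite_Iio N).subset
        (by rintro _ ⟨x, hx, rfl⟩; exact hx.2))
        (hf.mono fun x hx => hx.1)
    have hL : ∀ x, {a : G x | ε ≤ ‖h x n a‖}.Finite := fun x => by
      obtain ⟨F, hF⟩ := (hwit x).vanishes n ε hε
      refine F.finite_toSet.subset fun a ha => ?_
      by_contra h'
      exact absurd (hF a h') (not_lt.mpr ha)
    -- Large letters occur at finitely many vertices, by the decay along `f`, and finitely often at
    -- each, since scaling by at most `1` preserves vanishing at infinity.
    refine (hX.biUnion fun x _ => (hL x).image (Sigma.mk x)).subset ?_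
    rintro ⟨x, a⟩ ⟨ha, hε'⟩
    refine Set.mem_biUnion (x := x) ⟨⟨a, 1, ha⟩, ?_⟩ ⟨a, ?_, rfl⟩
    · by_contra h'
      exact absurd (hε'.trans (hnorm n x a ha)) (not_le.mpr (hN _ (not_lt.mp h')))
    · refine hε'.trans ?_
      change ‖normalise (r n x) (h x n) a‖ ≤ ‖h x n a‖
      rw [normalise_of_ne ha, norm_smul, Real.norm_of_nonneg (hr0 n x)]
      exact mul_le_of_le_one_left (norm_nonneg _) (scale_le_one _ _ _)
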